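/- Let $d$ be a natural number, let $r,s,t\in(0,1)$, put $m=sr+(1-r)t$, and let $\alpha,\beta\in[0,1]$. For $\gamma\in[0,1]$, $\lambda\in(0,1)$ and real numbers $x,y>0$ let $$M_\gamma^\lambda(x,y)=\left(\lambda x^\gamma+(1-\lambda)y^\gamma\right)^{1/\gamma}\ \text{ if }\gamma\neq 0,\qquad M_0^\lambda(x,y)=x^\lambda y^{1-\lambda},$$ and for vectors $x,y\in(0,\infty)^d$ let $M_\gamma^\lambda(x,y)\in(0,\infty)^d$ be the vector with coordinates $M_\gamma^\lambda(x,y)_i=M_\gamma^\lambda(x_i,y_i)$. Let $f_1,f_2,f_3,f_4:(0,\infty)^d\to(0,\infty)$ be Lebesgue measurable functions such that $$f_1(x)^m f_2(y)^{1-m}\le f_3\left(M_\alpha^s(x,y)\right)^r f_4\left(M_\beta^t(x,y)\right)^{1-r}\qquad\text{for all }x,y\in(0,\infty)^d.$$ Then $$\left(\int_{(0,\infty)^d} f_1\right)^m\left(\int_{(0,\infty)^d} f_2\right)^{1-m}\le\left(\int_{(0,\infty)^d} f_3\right)^r\left(\int_{(0,\infty)^d} f_4\right)^{1-r},$$ where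 the integrals are Lebesgue integrals with values in $(0,\infty]$. -/

import Mathlib

open MeasureTheory Set

/-- The weighted power mean of exponent `α` (a finite real number) of two positive reals, with
weight `w` on `x` and `1 - w` on `y`. The exponent `0` is understood in the limit, which is the
weighted geometric mean. -/
noncomputable def powerMean (α w x y : ℝ) : ℝ :=
  if α = 0 then x ^ w * y ^ (1 - w) else (w * x ^ α + (1 - w) * y ^ α) ^ (1 / α)

/-- The coordinatewise weighted power mean of two vectors. -/
noncomputable def powerMeanVec {d : ℕ} (α w : ℝ) (x y : Fin d → ℝ) : Fin d → ℝ :=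
  fun i => powerMean α w (x i) (y i)

/-- The open positive orthant `(0, ∞)^d`. -/
def posOrthant (d : ℕ) : Set (Fin d → ℝ) :=
  {x | ∀ i, 0 < x i}

/-! Mass transport in one dimension, then induction on `d`. On the half-line, let `u`, `v` be
increasing maps carrying the uniform law on (0,1) to the laws with densities proportional to f₁, f₂,
so that f₁(u)u' = ∫f₁ and f₂(v)v' = ∫f₂ almost everywhere. By AM-GM, the increasing curves A =
M_α^s(u,v) and B = M_β^t(u,v) satisfy A' ≥ u'^s v'^(1-s) and B' ≥ u'^t v'^(1-t). Since m = sr +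
(1-r)t, these combine to A'^r B'^(1-r) ≥ u'^m v'^(1-m), so (∫f₁)^m (∫f₂)^(1-m) ≤ (f₃(A)A')^r
(f₄(B)B')^(1-r) almost everywhere. Integrating over (0,1), Hölder and the changes of variable A and
B finish (`powerMean_transport_le`). By Tonelli, marginals inherit the hypothesis, which gives the
induction. -/

/-! ### Power means and their derivatives -/

theorem powerMean_pos {α w x y : ℝ} (hw : w ∈ Ioo (0 : ℝ) 1) (hx : 0 < x) (hy : 0 < y) :
    0 < powerMean α w x y := by
  have h1 : 0 < 1 - w := sub_pos.2 hw.2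
  have h0 := hw.1
  unfold powerMean
  split_ifs <;> positivity

theorem powerMean_mono {α w x y x' y' : ℝ} (hα : 0 ≤ α) (hw : w ∈ Ioo (0 : ℝ) 1)
    (hx : 0 < x) (hy : 0 < y) (hxx : x ≤ x') (hyy : y ≤ y') :
    powerMean α w x y ≤ powerMean α w x' y' := by
  have h1 : 0 < 1 - w := sub_pos.2 hw.2
  have h0 := hw.1
  unfold powerMean
  split_ifs
  · have := Real.rpow_nonneg (hx.le.trans hxx) w
    gcongr
  · gcongr

/-- The power mean of exponent in `[0, 1]` of two differentiable positive functions has derivative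
at least the geometric mean of their derivatives. -/
theorem exists_hasDerivAt_powerMean {α w : ℝ} (hα : α ∈ Icc (0 : ℝ) 1) (hw : w ∈ Ioo (0 : ℝ) 1)
    {u v : ℝ → ℝ} {τ u' v' : ℝ} (hu : 0 < u τ) (hv : 0 < v τ) (hu' : 0 ≤ u') (hv' : 0 ≤ v')
    (hdu : HasDerivAt u u' τ) (hdv : HasDerivAt v v' τ) :
    ∃ w', HasDerivAt (fun τ => powerMean α w (u τ) (v τ)) w' τ ∧
      u' ^ w * v' ^ (1 - w) ≤ w' := by
  have h1 : 0 < 1 - w := sub_pos.2 hw.2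
  have h0 := hw.1
  rcases eq_or_ne α 0 with rfl | hne
  · simp only [powerMean, if_true]
    refine ⟨_, (hdu.rpow_const (Or.inl hu.ne')).mul (hdv.rpow_const (Or.inl hv.ne')), ?_⟩
    -- AM-GM for the logarithmic derivatives u'/u and v'/v, to be multiplied by the geometric mean
    -- of u and v.
    have key := Real.geom_mean_le_arith_mean2_weighted h0.le h1.le
      (div_nonneg hu' hu.le) (div_nonneg hv' hv.le) (by ring)
    rw [Real.div_rpow hu' hu.le, Real.div_rpow hv' hv.le] at key
    have hP : 0 < u τ ^ w * v τ ^ (1 - w) := by positivity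
    have := mul_le_mul_of_nonneg_left key hP.le
    rw [Real.rpow_sub_one hu.ne', Real.rpow_sub_one hv.ne']
    refine le_trans (le_of_eq ?_) (this.trans (le_of_eq ?_))
    · field_simp
    · ring
  · have hα0 : 0 < α := lt_of_le_of_ne hα.1 hne.symm
    simp only [powerMean, if_neg hne]
    have hS : 0 < w * u τ ^ α + (1 - w) * v τ ^ α := by positivity
    refine ⟨_, (((hdu.rpow_const (p := α) (Or.inl hu.ne')).const_mul w).add
      ((hdv.rpow_const (p := α) (Or.inl hv.ne')).const_mul (1 - w))).rpow_const
        (p := 1 / α) (Or.inl hS.ne'), ?_⟩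
    -- With S the weighted sum of α-th powers, the derivative is S^(1/α-1) (w u^(α-1) u' + (1-w)
    -- v^(α-1) v'). AM-GM bounds the factors below by P^(1-α), as α ≤ 1, and by P^(α-1) u'^w
    -- v'^(1-w); the powers of P cancel.
    set P := u τ ^ w * v τ ^ (1 - w) with hPdef
    have hP : 0 < P := by positivity
    have hPα : P ^ α = (u τ ^ α) ^ w * (v τ ^ α) ^ (1 - w) := by
      rw [hPdef, Real.mul_rpow (by positivity) (by positivity), ← Real.rpow_mul hu.le,
        ← Real.rpow_mul hv.le, ← Real.rpow_mul hu.le, ← Real.rpow_mul hv.le, mul_comm w,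
        mul_comm (1 - w)]
    have hPα1 : P ^ (α - 1) = (u τ ^ (α - 1)) ^ w * (v τ ^ (α - 1)) ^ (1 - w) := by
      rw [hPdef, Real.mul_rpow (by positivity) (by positivity), ← Real.rpow_mul hu.le,
        ← Real.rpow_mul hv.le, ← Real.rpow_mul hu.le, ← Real.rpow_mul hv.le, mul_comm w,
        mul_comm (1 - w)]
    have hPS : P ^ α ≤ w * u τ ^ α + (1 - w) * v τ ^ α := by
      rw [hPα]
      exact Real.geom_mean_le_arith_mean2_weighted h0.le h1.le (by positivity) (by positivity)
        (by ring)
    have hS1 : P ^ (1 - α) ≤ (w * u τ ^ α + (1 - w) * v τ ^ α) ^ (1 / α - 1) := by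
      have : P ^ (1 - α) = (P ^ α) ^ (1 / α - 1) := by
        rw [← Real.rpow_mul hP.le]; congr 1; field_simp
      rw [this]
      refine Real.rpow_le_rpow (by positivity) hPS ?_
      rw [sub_nonneg, le_div_iff₀ hα0]; linarith [hα.2]
    have key := Real.geom_mean_le_arith_mean2_weighted h0.le h1.le
      (mul_nonneg (Real.rpow_nonneg hu.le (α - 1)) hu')
      (mul_nonneg (Real.rpow_nonneg hv.le (α - 1)) hv') (by ring)
    rw [Real.mul_rpow (by positivity) hu', Real.mul_rpow (by positivity) hv'] at key
    have key' := mul_le_mul key hS1 (by positivity) (by positivity)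
    refine le_trans (le_of_eq ?_) (key'.trans (le_of_eq ?_))
    · have : P ^ (α - 1) * P ^ (1 - α) = 1 := by
        rw [← Real.rpow_add hP]; simp
      rw [hPα1] at this
      linear_combination -(u' ^ w * v' ^ (1 - w)) * this
    · simp only [Pi.add_apply]
      field_simp

/-! ### Monotone transport on the line -/

/-- The increasing transport map from the uniform law on `(0, 1)` to the law of density
proportional to a bounded function of bounded support. -/
theorem exists_transport {g : ℝ → ℝ} {b C : ℝ} (hg : Measurable g) (h0 : ∀ x, 0 ≤ g x)
    (hC : ∀ x, g x ≤ C) (hsupp : ∀ x, x ∉ Ioo 0 b → g x = 0) (hpos : 0 < ∫ x, g x) :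
    ∃ u : ℝ → ℝ, MonotoneOn u (Ioo 0 1) ∧ (∀ τ ∈ Ioo (0 : ℝ) 1, 0 < u τ) ∧
      ∀ᵐ τ, τ ∈ Ioo (0 : ℝ) 1 → ∃ u', 0 ≤ u' ∧ HasDerivAt u u' τ ∧ g (u τ) * u' = ∫ x, g x := by
  set I := ∫ x, g x with hI
  have hint : Integrable g := by
    have : IntegrableOn g (Ioo 0 b) :=
      Measure.integrableOn_of_bounded (M := C) (by simp) hg.aestronglyMeasurable
        (Filter.Eventually.of_forall fun x => by rw [Real.norm_of_nonneg (h0 x)]; exact hC x)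
    exact this.integrable_of_forall_notMem_eq_zero hsupp
  have hb : 0 ≤ b := by
    by_contra! hb
    have : ∀ x, g x = 0 := fun x => hsupp x (by simp [Ioo_eq_empty (not_lt.2 hb.le)])
    simp [I, this] at hpos
  have hii : ∀ x y, IntervalIntegrable g volume x y := fun x y => hint.intervalIntegrable
  let G : ℝ → ℝ := fun x => ∫ t in (0 : ℝ)..x, g t
  have hG0 : G 0 = 0 := by simp [G]
  have hGb : G b = I := by
    simp only [G, intervalIntegral.integral_of_le hb, hI]
    refine setIntegral_eq_integral_of_forall_compl_eq_zero fun x hx => hsupp x fun h => hx ?_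
    exact Ioo_subset_Ioc_self h
  have hGsub : ∀ x y, G y - G x = ∫ t in x..y, g t := fun x y =>
    intervalIntegral.integral_interval_sub_left (hii _ _) (hii _ _)
  have hGmono : Monotone G := fun x y hxy => by
    have := intervalIntegral.integral_nonneg (μ := volume) hxy (fun t _ => h0 t)
    linarith [hGsub x y]
  have hGlip : LipschitzWith C.toNNReal G := by
    refine LipschitzWith.of_dist_le_mul fun x y => ?_
    rw [Real.dist_eq, Real.dist_eq, hGsub, Real.coe_toNNReal _ ((h0 0).trans (hC 0))]
    exact intervalIntegral.norm_integral_le_of_norm_le_const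
      fun t _ => by rw [Real.norm_of_nonneg (h0 t)]; exact hC t
  -- G may be flat on intervals, so u is any choice of preimages; monotonicity of G still forces u
  -- to be monotone.
  have hex : ∀ τ : ℝ, ∃ x, τ ∈ Ioo (0 : ℝ) 1 → x ∈ Icc 0 b ∧ G x = τ * I := by
    intro τ
    by_cases hτ : τ ∈ Ioo (0 : ℝ) 1
    · obtain ⟨x, hx, hxe⟩ := intermediate_value_Icc hb hGlip.continuous.continuousOn
        (show τ * I ∈ Icc (G 0) (G b) by
          rw [hG0, hGb]
          exact ⟨mul_nonneg hτ.1.le hpos.le, mul_le_of_le_one_left hpos.le hτ.2.le⟩)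
      exact ⟨x, fun _ => ⟨hx, hxe⟩⟩
    · exact ⟨0, fun h => absurd h hτ⟩
  choose u hu using hex
  have humono : MonotoneOn u (Ioo 0 1) := fun a ha c hc hac => by
    rcases hac.eq_or_lt with rfl | hlt
    · exact le_rfl
    by_contra! hcon
    have := hGmono hcon.le
    rw [(hu a ha).2, (hu c hc).2] at this
    exact absurd (le_of_mul_le_mul_right this hpos) (not_le.2 hlt)
  refine ⟨u, humono, fun τ hτ => ?_, ?_⟩
  · refine lt_of_le_of_ne (hu τ hτ).1.1 fun h => ?_
    have := (hu τ hτ).2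
    rw [← h, hG0] at this
    exact (mul_pos hτ.1 hpos).ne this
  have hLDT := LocallyIntegrable.ae_hasDerivAt_integral hint.locallyIntegrable
  -- Points where Lebesgue differentiation fails. N is null and G/I is Lipschitz because g is
  -- bounded, so the image of N is null and u τ avoids N for almost every τ.
  set N := {x | ¬ ∀ c, HasDerivAt (fun x => ∫ t in c..x, g t) (g x) x} with hN
  have hN0 : volume N = 0 := hLDT
  have hGN : volume ((fun x => G x / I) '' N) = 0 := by
    have hlip : LipschitzWith (‖I⁻¹‖₊ * C.toNNReal) (fun x => I⁻¹ * G x) :=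
      (lipschitzWith_smul (β := ℝ) I⁻¹).comp hGlip
    have := (hlip.lipschitzOnWith (s := N)).hausdorffMeasure_image_le (d := 1) zero_le_one
    rw [hausdorffMeasure_real] at this
    simpa [hN0, div_eq_inv_mul] using this
  have hGN' : ∀ᵐ τ, τ ∉ (fun x => G x / I) '' N := measure_eq_zero_iff_ae_notMem.1 hGN
  filter_upwards [hGN', humono.ae_differentiableWithinAt_of_mem] with τ h1 h2 hτ
  have hd := (h2 hτ).differentiableAt (isOpen_Ioo.mem_nhds hτ)
  have hder : HasDerivAt G (g (u τ)) (u τ) := by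
    by_contra hcon
    refine h1 ⟨u τ, fun h => hcon (h 0), ?_⟩
    simp only
    rw [(hu τ hτ).2, mul_div_cancel_right₀ _ hpos.ne']
  have hcomp := hder.comp τ hd.hasDerivAt
  have hid : HasDerivAt (G ∘ u) (1 * I) τ := by
    refine ((hasDerivAt_id τ).mul_const I).congr_of_eventuallyEq ?_
    filter_upwards [isOpen_Ioo.mem_nhds hτ] with σ hσ
    exact (hu σ hσ).2
  refine ⟨deriv u τ, ?_, hd.hasDerivAt, by simpa using hcomp.unique hid⟩
  rw [← hd.derivWithin (isOpen_Ioo.uniqueDiffWithinAt hτ)]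
  exact humono.derivWithin_nonneg

/-! ### The one-dimensional inequality -/

theorem powerMean_transport_le {r s t m α β : ℝ}
    (hr : r ∈ Ioo (0 : ℝ) 1) (hs : s ∈ Ioo (0 : ℝ) 1) (ht : t ∈ Ioo (0 : ℝ) 1)
    (hm : m = s * r + (1 - r) * t) (hα : α ∈ Icc (0 : ℝ) 1) (hβ : β ∈ Icc (0 : ℝ) 1)
    {g₁ g₂ : ℝ → ℝ} {f₃ f₄ : ℝ → ENNReal} {b C : ℝ} (hg₁ : Measurable g₁) (hg₂ : Measurable g₂)
    (h₁ : ∀ x, 0 ≤ g₁ x) (h₂ : ∀ x, 0 ≤ g₂ x) (hC₁ : ∀ x, g₁ x ≤ C) (hC₂ : ∀ x, g₂ x ≤ C)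
    (hsupp₁ : ∀ x, x ∉ Ioo 0 b → g₁ x = 0) (hsupp₂ : ∀ x, x ∉ Ioo 0 b → g₂ x = 0)
    (hpos₁ : 0 < ∫ x, g₁ x) (hpos₂ : 0 < ∫ x, g₂ x)
    (hf₃ : Measurable f₃) (hf₄ : Measurable f₄)
    (hineq : ∀ x y, 0 < x → 0 < y → ENNReal.ofReal (g₁ x) ^ m * ENNReal.ofReal (g₂ y) ^ (1 - m) ≤
      f₃ (powerMean α s x y) ^ r * f₄ (powerMean β t x y) ^ (1 - r)) :
    ENNReal.ofReal (∫ x, g₁ x) ^ m * ENNReal.ofReal (∫ x, g₂ x) ^ (1 - m) ≤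
      (∫⁻ x in Ioi 0, f₃ x) ^ r * (∫⁻ x in Ioi 0, f₄ x) ^ (1 - r) := by
  have hr0 := hr.1.le
  have hr1 : 0 ≤ 1 - r := sub_nonneg.2 hr.2.le
  have hs0 := hs.1.le
  have hs1 : 0 ≤ 1 - s := sub_nonneg.2 hs.2.le
  have ht0 := ht.1.le
  have ht1 : 0 ≤ 1 - t := sub_nonneg.2 ht.2.le
  have hm0 : 0 ≤ m := by rw [hm]; positivity
  have hm1' : 1 - m = (1 - s) * r + (1 - t) * (1 - r) := by rw [hm]; ring
  have hm1 : 0 ≤ 1 - m := by rw [hm1']; positivity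
  obtain ⟨u, hu, hu0, hud⟩ := exists_transport hg₁ h₁ hC₁ hsupp₁ hpos₁
  obtain ⟨v, hv, hv0, hvd⟩ := exists_transport hg₂ h₂ hC₂ hsupp₂ hpos₂
  obtain ⟨S, hSm, hSsub, hSvol, hSu, hSv⟩ : ∃ S : Set ℝ, MeasurableSet S ∧ S ⊆ Ioo 0 1 ∧
      volume S = 1 ∧
      (∀ τ ∈ S, ∃ u', 0 ≤ u' ∧ HasDerivAt u u' τ ∧ g₁ (u τ) * u' = ∫ x, g₁ x) ∧
      (∀ τ ∈ S, ∃ v', 0 ≤ v' ∧ HasDerivAt v v' τ ∧ g₂ (v τ) * v' = ∫ x, g₂ x) := by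
    have hae := hud.and hvd
    obtain ⟨N, hNsub, hNm, hN0⟩ := exists_measurable_superset_of_null (ae_iff.1 hae)
    refine ⟨Ioo 0 1 \ N, measurableSet_Ioo.diff hNm, sdiff_subset, ?_, ?_, ?_⟩
    · rw [measure_sdiff_null hN0]; simp
    · intro τ hτ
      by_contra hcon
      exact hτ.2 (hNsub fun h => hcon (h.1 hτ.1))
    · intro τ hτ
      by_contra hcon
      exact hτ.2 (hNsub fun h => hcon (h.2 hτ.1))
  have hmono : ∀ {γ l : ℝ}, γ ∈ Icc (0 : ℝ) 1 → l ∈ Ioo (0 : ℝ) 1 →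
      MonotoneOn (fun τ => powerMean γ l (u τ) (v τ)) S := fun hγ hl a ha c hc hac =>
    powerMean_mono hγ.1 hl (hu0 a (hSsub ha)) (hv0 a (hSsub ha)) (hu (hSsub ha) (hSsub hc) hac)
      (hv (hSsub ha) (hSsub hc) hac)
  have hdiff : ∀ {γ l : ℝ}, γ ∈ Icc (0 : ℝ) 1 → l ∈ Ioo (0 : ℝ) 1 → ∀ τ ∈ S,
      DifferentiableAt ℝ (fun τ => powerMean γ l (u τ) (v τ)) τ := by
    intro γ l hγ hl τ hτ
    obtain ⟨u', hu', hdu, -⟩ := hSu τ hτ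
    obtain ⟨v', hv', hdv, -⟩ := hSv τ hτ
    obtain ⟨w', hw, -⟩ := exists_hasDerivAt_powerMean hγ hl (hu0 τ (hSsub hτ)) (hv0 τ (hSsub hτ))
      hu' hv' hdu hdv
    exact hw.differentiableAt
  have hmeas : ∀ {γ l : ℝ} {f : ℝ → ENNReal}, γ ∈ Icc (0 : ℝ) 1 → l ∈ Ioo (0 : ℝ) 1 →
      Measurable f → AEMeasurable (fun τ =>
        ENNReal.ofReal (deriv (fun τ => powerMean γ l (u τ) (v τ)) τ) *
          f (powerMean γ l (u τ) (v τ))) (volume.restrict S) := fun hγ hl hf =>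
    (measurable_deriv _).ennreal_ofReal.aemeasurable.mul
      (hf.comp_aemeasurable (aemeasurable_restrict_of_monotoneOn hSm (hmono hγ hl)))
  -- The curve may jump, so its image may miss part of the half-line; only this inequality is
  -- needed.
  have hchange : ∀ {γ l : ℝ} {f : ℝ → ENNReal}, γ ∈ Icc (0 : ℝ) 1 → l ∈ Ioo (0 : ℝ) 1 →
      ∫⁻ τ in S, ENNReal.ofReal (deriv (fun τ => powerMean γ l (u τ) (v τ)) τ) *
          f (powerMean γ l (u τ) (v τ)) ≤ ∫⁻ x in Ioi 0, f x := by
    intro γ l f hγ hl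
    rw [← lintegral_image_eq_lintegral_deriv_mul_of_monotoneOn hSm
      (fun τ hτ => (hdiff hγ hl τ hτ).hasDerivAt.hasDerivWithinAt) (hmono hγ hl)]
    refine lintegral_mono_set ?_
    rintro _ ⟨τ, hτ, rfl⟩
    exact powerMean_pos hl (hu0 τ (hSsub hτ)) (hv0 τ (hSsub hτ))
  calc ENNReal.ofReal (∫ x, g₁ x) ^ m * ENNReal.ofReal (∫ x, g₂ x) ^ (1 - m)
      = ∫⁻ _ in S, ENNReal.ofReal (∫ x, g₁ x) ^ m * ENNReal.ofReal (∫ x, g₂ x) ^ (1 - m) := by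
        rw [setLIntegral_const, hSvol, mul_one]
    _ ≤ ∫⁻ τ in S, (ENNReal.ofReal (deriv (fun τ => powerMean α s (u τ) (v τ)) τ) *
          f₃ (powerMean α s (u τ) (v τ))) ^ r *
          (ENNReal.ofReal (deriv (fun τ => powerMean β t (u τ) (v τ)) τ) *
          f₄ (powerMean β t (u τ) (v τ))) ^ (1 - r) := by
        refine setLIntegral_mono' hSm fun τ hτ => ?_
        have hup := hu0 τ (hSsub hτ)
        have hvp := hv0 τ (hSsub hτ)
        obtain ⟨u', hu', hdu, hue⟩ := hSu τ hτ
        obtain ⟨v', hv', hdv, hve⟩ := hSv τ hτ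
        obtain ⟨a, ha, hale⟩ := exists_hasDerivAt_powerMean hα hs hup hvp hu' hv' hdu hdv
        obtain ⟨c, hc, hcle⟩ := exists_hasDerivAt_powerMean hβ ht hup hvp hu' hv' hdu hdv
        rw [ha.deriv, hc.deriv, ← hue, ← hve, ENNReal.ofReal_mul (h₁ _), ENNReal.ofReal_mul (h₂ _),
          ENNReal.mul_rpow_of_nonneg _ _ hm0, ENNReal.mul_rpow_of_nonneg _ _ hm1,
          ENNReal.mul_rpow_of_nonneg _ _ hr0, ENNReal.mul_rpow_of_nonneg _ _ hr1,
          mul_mul_mul_comm, mul_mul_mul_comm (ENNReal.ofReal a ^ r),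
          mul_comm (ENNReal.ofReal a ^ r * _)]
        refine mul_le_mul' (hineq _ _ hup hvp) ?_
        have ha' : ENNReal.ofReal u' ^ s * ENNReal.ofReal v' ^ (1 - s) ≤ ENNReal.ofReal a := by
          rw [ENNReal.ofReal_rpow_of_nonneg hu' hs0, ENNReal.ofReal_rpow_of_nonneg hv' hs1,
            ← ENNReal.ofReal_mul (by positivity)]
          exact ENNReal.ofReal_le_ofReal hale
        have hc' : ENNReal.ofReal u' ^ t * ENNReal.ofReal v' ^ (1 - t) ≤ ENNReal.ofReal c := by
          rw [ENNReal.ofReal_rpow_of_nonneg hu' ht0, ENNReal.ofReal_rpow_of_nonneg hv' ht1,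
            ← ENNReal.ofReal_mul (by positivity)]
          exact ENNReal.ofReal_le_ofReal hcle
        refine le_trans (le_of_eq ?_) (mul_le_mul' (ENNReal.rpow_le_rpow ha' hr0)
          (ENNReal.rpow_le_rpow hc' hr1))
        rw [ENNReal.mul_rpow_of_nonneg _ _ hr0, ENNReal.mul_rpow_of_nonneg _ _ hr1,
          ← ENNReal.rpow_mul, ← ENNReal.rpow_mul, ← ENNReal.rpow_mul, ← ENNReal.rpow_mul,
          mul_mul_mul_comm, ← ENNReal.rpow_add_of_nonneg _ _ (by positivity) (by positivity),
          ← ENNReal.rpow_add_of_nonneg _ _ (by positivity) (by positivity), hm1', hm,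
          mul_comm (1 - r) t]
    _ ≤ _ := ENNReal.lintegral_mul_norm_pow_le (hmeas hα hs hf₃) (hmeas hβ ht hf₄) hr0 hr1 (by ring)
    _ ≤ _ := mul_le_mul' (ENNReal.rpow_le_rpow (hchange hα hs) hr0)
        (ENNReal.rpow_le_rpow (hchange hβ ht) hr1)

/-- The bounded, boundedly supported truncation of an extended nonnegative function. -/
noncomputable def truncation (f : ℝ → ENNReal) (n : ℕ) : ℝ → ℝ :=
  (Ioo (0 : ℝ) n).indicator fun x => (min (f x) n).toReal

theorem truncation_nonneg (f : ℝ → ENNReal) (n : ℕ) (x : ℝ) : 0 ≤ truncation f n x :=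
  indicator_nonneg (fun _ _ => ENNReal.toReal_nonneg) x

theorem truncation_le (f : ℝ → ENNReal) (n : ℕ) (x : ℝ) : truncation f n x ≤ n :=
  indicator_le' (fun x _ => by
    simpa using ENNReal.toReal_mono (ENNReal.natCast_ne_top n) (min_le_right (f x) n))
    (fun _ _ => Nat.cast_nonneg n) x

theorem truncation_of_notMem (f : ℝ → ENNReal) (n : ℕ) (x : ℝ) (hx : x ∉ Ioo (0 : ℝ) n) :
    truncation f n x = 0 :=
  indicator_of_notMem hx _

theorem measurable_truncation {f : ℝ → ENNReal} (hf : Measurable f) (n : ℕ) :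
    Measurable (truncation f n) :=
  (hf.min measurable_const).ennreal_toReal.indicator measurableSet_Ioo

theorem ofReal_truncation (f : ℝ → ENNReal) (n : ℕ) (x : ℝ) :
    ENNReal.ofReal (truncation f n x) = (Ioo (0 : ℝ) n).indicator (fun x => min (f x) n) x := by
  by_cases hx : x ∈ Ioo (0 : ℝ) n
  · rw [truncation, indicator_of_mem hx, indicator_of_mem hx, ENNReal.ofReal_toReal]
    exact ne_top_of_le_ne_top (ENNReal.natCast_ne_top n) (min_le_right _ _)
  · simp [truncation, hx]

theorem ofReal_truncation_le (f : ℝ → ENNReal) (n : ℕ) (x : ℝ) :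
    ENNReal.ofReal (truncation f n x) ≤ f x := by
  rw [ofReal_truncation]
  exact indicator_le (fun x _ => min_le_left _ _) x

theorem ofReal_integral_truncation {f : ℝ → ENNReal} (hf : Measurable f) (n : ℕ) :
    ENNReal.ofReal (∫ x, truncation f n x) = ∫⁻ x, ENNReal.ofReal (truncation f n x) := by
  have hint : IntegrableOn (truncation f n) (Ioo (0 : ℝ) n) :=
    Measure.integrableOn_of_bounded (M := n) (by simp)
      (measurable_truncation hf n).aestronglyMeasurable
      (Filter.Eventually.of_forall fun x => by
        rw [Real.norm_of_nonneg (truncation_nonneg f n x)]; exact truncation_le f n x)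
  exact ofReal_integral_eq_lintegral_ofReal
    (hint.integrable_of_forall_notMem_eq_zero (truncation_of_notMem f n))
    (Filter.Eventually.of_forall (truncation_nonneg f n))

theorem tendsto_lintegral_truncation {f : ℝ → ENNReal} (hf : Measurable f) :
    Filter.Tendsto (fun n => ENNReal.ofReal (∫ x, truncation f n x)) Filter.atTop
      (nhds (∫⁻ x in Ioi 0, f x)) := by
  simp_rw [ofReal_integral_truncation hf]
  rw [← lintegral_indicator measurableSet_Ioi]
  refine lintegral_tendsto_of_tendsto_of_monotone
    (fun n => (measurable_truncation hf n).ennreal_ofReal.aemeasurable)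
    (Filter.Eventually.of_forall fun x k n hkn => ?_) (Filter.Eventually.of_forall fun x => ?_)
  · have hkn' : (k : ℝ) ≤ n := Nat.cast_le.2 hkn
    simp only [ofReal_truncation]
    refine (indicator_le_indicator_of_subset (Ioo_subset_Ioo_right hkn') (fun _ => zero_le) x).trans
      (indicator_le_indicator (min_le_min_left _ (Nat.cast_le.2 hkn)))
  · simp only [ofReal_truncation]
    by_cases hx : 0 < x
    · rw [indicator_of_mem (mem_Ioi.2 hx)]
      have h : Filter.Tendsto (fun n : ℕ => min (f x) n) Filter.atTop (nhds (min (f x) ⊤)) :=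
        tendsto_const_nhds.min ENNReal.tendsto_nat_nhds_top
      rw [min_top_right] at h
      refine h.congr' ?_
      filter_upwards [tendsto_natCast_atTop_atTop.eventually (Filter.eventually_gt_atTop x)] with n hn
      rw [indicator_of_mem (show x ∈ Ioo (0 : ℝ) n from ⟨hx, hn⟩)]
    · have : ∀ n : ℕ, x ∉ Ioo (0 : ℝ) n := fun n h => hx h.1
      simp [this, hx]

/-- Truncating f₁ and f₂ only lowers the left side of the hypothesis, so the transport bound holds
for every truncation and passes to the limit by monotone convergence. -/
theorem powerMean_lintegral_le {r s t m α β : ℝ}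
    (hr : r ∈ Ioo (0 : ℝ) 1) (hs : s ∈ Ioo (0 : ℝ) 1) (ht : t ∈ Ioo (0 : ℝ) 1)
    (hm : m = s * r + (1 - r) * t) (hα : α ∈ Icc (0 : ℝ) 1) (hβ : β ∈ Icc (0 : ℝ) 1)
    {f₁ f₂ f₃ f₄ : ℝ → ENNReal} (hf₁ : Measurable f₁) (hf₂ : Measurable f₂)
    (hf₃ : Measurable f₃) (hf₄ : Measurable f₄)
    (hineq : ∀ x y, 0 < x → 0 < y → f₁ x ^ m * f₂ y ^ (1 - m) ≤
      f₃ (powerMean α s x y) ^ r * f₄ (powerMean β t x y) ^ (1 - r)) :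
    (∫⁻ x in Ioi 0, f₁ x) ^ m * (∫⁻ x in Ioi 0, f₂ x) ^ (1 - m) ≤
      (∫⁻ x in Ioi 0, f₃ x) ^ r * (∫⁻ x in Ioi 0, f₄ x) ^ (1 - r) := by
  have hr0 := hr.1
  have hs0 := hs.1
  have ht0 := ht.1
  have hr1 : 0 < 1 - r := sub_pos.2 hr.2
  have hs1 : 0 < 1 - s := sub_pos.2 hs.2
  have ht1 : 0 < 1 - t := sub_pos.2 ht.2
  have hm0 : 0 < m := by rw [hm]; positivity
  have hm1 : 0 < 1 - m := by
    rw [show 1 - m = (1 - s) * r + (1 - t) * (1 - r) by rw [hm]; ring]; positivity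
  rcases eq_or_ne (∫⁻ x in Ioi 0, f₁ x) 0 with h1 | h1
  · simp [h1, hm0]
  rcases eq_or_ne (∫⁻ x in Ioi 0, f₂ x) 0 with h2 | h2
  · simp [h2, hm1]
  have key : ∀ n : ℕ, ENNReal.ofReal (∫ x, truncation f₁ n x) ^ m *
      ENNReal.ofReal (∫ x, truncation f₂ n x) ^ (1 - m) ≤
      (∫⁻ x in Ioi 0, f₃ x) ^ r * (∫⁻ x in Ioi 0, f₄ x) ^ (1 - r) := by
    intro n
    rcases le_or_gt (∫ x, truncation f₁ n x) 0 with h | hp₁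
    · simp [ENNReal.ofReal_eq_zero.2 h, hm0]
    rcases le_or_gt (∫ x, truncation f₂ n x) 0 with h | hp₂
    · simp [ENNReal.ofReal_eq_zero.2 h, hm1]
    exact powerMean_transport_le hr hs ht hm hα hβ (measurable_truncation hf₁ n)
      (measurable_truncation hf₂ n) (truncation_nonneg _ _) (truncation_nonneg _ _)
      (truncation_le _ _) (truncation_le _ _) (truncation_of_notMem _ _) (truncation_of_notMem _ _)
      hp₁ hp₂ hf₃ hf₄ fun x y hx hy =>
        (mul_le_mul' (ENNReal.rpow_le_rpow (ofReal_truncation_le _ _ _) hm0.le)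
          (ENNReal.rpow_le_rpow (ofReal_truncation_le _ _ _) hm1.le)).trans (hineq x y hx hy)
  -- Both limits are nonzero, which excludes 0 · ∞, where multiplication is discontinuous.
  refine le_of_tendsto' (ENNReal.Tendsto.mul
    ((tendsto_lintegral_truncation hf₁).ennrpow_const m) (Or.inl ?_)
    ((tendsto_lintegral_truncation hf₂).ennrpow_const (1 - m)) (Or.inl ?_)) key
  · simp only [ne_eq, ENNReal.rpow_eq_zero_iff, h1, not_lt.2 hm0.le, false_and, and_false, or_false,
      not_false_eq_true]
  · simp only [ne_eq, ENNReal.rpow_eq_zero_iff, h2, not_lt.2 hm1.le, false_and, and_false, or_false,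
      not_false_eq_true]

/-! ### Induction on the dimension -/

theorem volume_restrict_posOrthant (d : ℕ) :
    (volume.restrict (posOrthant d) : Measure (Fin d → ℝ)) =
      Measure.pi fun _ => volume.restrict (Ioi 0) := by
  rw [← Measure.restrict_pi_pi, volume_pi]
  congr 1
  ext x
  simp [posOrthant]

theorem cons_mem_posOrthant {d : ℕ} {a : ℝ} {x : Fin d → ℝ} (ha : 0 < a)
    (hx : x ∈ posOrthant d) : (Fin.cons a x : Fin (d + 1) → ℝ) ∈ posOrthant (d + 1) :=
  Fin.cases ha hx

theorem powerMeanVec_cons {d : ℕ} (α w a b : ℝ) (x y : Fin d → ℝ) :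
    powerMeanVec α w (Fin.cons a x : Fin (d + 1) → ℝ) (Fin.cons b y) =
      Fin.cons (powerMean α w a b) (powerMeanVec α w x y) := by
  ext i
  refine Fin.cases ?_ (fun j => ?_) i <;> simp [powerMeanVec]

theorem measurable_finCons (d : ℕ) :
    Measurable fun p : ℝ × (Fin d → ℝ) => (Fin.cons p.1 p.2 : Fin (d + 1) → ℝ) :=
  measurable_pi_iff.2 (Fin.cases (by simpa using measurable_fst) fun j => by
    simpa [Function.comp_def] using (measurable_pi_apply j).comp measurable_snd)

theorem lintegral_posOrthant_succ {d : ℕ} {f : (Fin (d + 1) → ℝ) → ENNReal} (hf : Measurable f) :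
    ∫⁻ x in posOrthant (d + 1), f x =
      ∫⁻ a in Ioi 0, ∫⁻ x in posOrthant d, f (Fin.cons a x) := by
  have hmp := (measurePreserving_piFinSuccAbove
    (fun _ : Fin (d + 1) => (volume.restrict (Ioi (0 : ℝ)))) 0).symm
  rw [volume_restrict_posOrthant, volume_restrict_posOrthant, ← hmp.lintegral_comp hf,
    lintegral_prod _ (by exact (hf.comp (MeasurableEquiv.measurable _)).aemeasurable)]
  exact lintegral_congr fun a => lintegral_congr fun x => congrArg f (Fin.insertNth_zero' a x)

/-- Fixing the first coordinates a, b, the sections satisfy the d-dimensional hypothesis with f₃, f₄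
cut at the means of a and b. The resulting bound is the one-dimensional hypothesis for the
marginals. Values in `ENNReal` allow these to be infinite. -/
theorem powerMeanVec_lintegral_le {r s t m α β : ℝ}
    (hr : r ∈ Ioo (0 : ℝ) 1) (hs : s ∈ Ioo (0 : ℝ) 1) (ht : t ∈ Ioo (0 : ℝ) 1)
    (hm : m = s * r + (1 - r) * t) (hα : α ∈ Icc (0 : ℝ) 1) (hβ : β ∈ Icc (0 : ℝ) 1)
    (d : ℕ) {f₁ f₂ f₃ f₄ : (Fin d → ℝ) → ENNReal} (hf₁ : Measurable f₁) (hf₂ : Measurable f₂)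
    (hf₃ : Measurable f₃) (hf₄ : Measurable f₄)
    (hineq : ∀ x ∈ posOrthant d, ∀ y ∈ posOrthant d, f₁ x ^ m * f₂ y ^ (1 - m) ≤
      f₃ (powerMeanVec α s x y) ^ r * f₄ (powerMeanVec β t x y) ^ (1 - r)) :
    (∫⁻ x in posOrthant d, f₁ x) ^ m * (∫⁻ x in posOrthant d, f₂ x) ^ (1 - m) ≤
      (∫⁻ x in posOrthant d, f₃ x) ^ r * (∫⁻ x in posOrthant d, f₄ x) ^ (1 - r) := by
  induction d with
  | zero =>
    have h0 : ∀ x : Fin 0 → ℝ, x ∈ posOrthant 0 := fun _ i => i.elim0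
    have hdirac : ∀ (f : (Fin 0 → ℝ) → ENNReal) (x : Fin 0 → ℝ),
        ∫⁻ x in posOrthant 0, f x = f x := fun f x => by
      rw [volume_restrict_posOrthant, Measure.pi_of_empty _ x, lintegral_dirac]
    have := hineq 0 (h0 0) 0 (h0 0)
    rwa [← hdirac f₁, ← hdirac f₂, ← hdirac f₃, ← hdirac f₄] at this
  | succ d ih =>
    have hsec : ∀ {f : (Fin (d + 1) → ℝ) → ENNReal}, Measurable f → ∀ a : ℝ,
        Measurable fun x : Fin d → ℝ => f (Fin.cons a x) := fun hf a =>
      (hf.comp (measurable_finCons d)).comp measurable_prodMk_left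
    have hmarg : ∀ {f : (Fin (d + 1) → ℝ) → ENNReal}, Measurable f →
        Measurable fun a : ℝ => ∫⁻ x in posOrthant d, f (Fin.cons a x) := fun hf =>
      (hf.comp (measurable_finCons d)).lintegral_prod_right'
    rw [lintegral_posOrthant_succ hf₁, lintegral_posOrthant_succ hf₂,
      lintegral_posOrthant_succ hf₃, lintegral_posOrthant_succ hf₄]
    refine powerMean_lintegral_le hr hs ht hm hα hβ (hmarg hf₁) (hmarg hf₂) (hmarg hf₃)
      (hmarg hf₄) fun a b ha hb => ?_
    refine ih (hsec hf₁ _) (hsec hf₂ _) (hsec hf₃ _) (hsec hf₄ _) fun x hx y hy => ?_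
    have := hineq _ (cons_mem_posOrthant ha hx) _ (cons_mem_posOrthant hb hy)
    rwa [powerMeanVec_cons, powerMeanVec_cons] at this

/-! ### From almost everywhere measurable to measurable functions -/

theorem exists_measurable_ge_lintegral_eq {X : Type*} [MeasurableSpace X] {μ : Measure X}
    {f : X → ENNReal} (hf : AEMeasurable f μ) :
    ∃ g : X → ENNReal, Measurable g ∧ f ≤ g ∧ ∫⁻ x, g x ∂μ = ∫⁻ x, f x ∂μ := by
  classical
  -- Setting the majorant to ⊤ on a measurable null set makes the domination hold at every point, as
  -- a pointwise hypothesis requires.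
  obtain ⟨N, hNsub, hNm, hN0⟩ := exists_measurable_superset_of_null (ae_iff.1 hf.ae_eq_mk)
  refine ⟨N.piecewise (fun _ => ⊤) (hf.mk f), measurable_const.piecewise hNm hf.measurable_mk,
    fun x => ?_, lintegral_congr_ae ?_⟩
  · by_cases hx : x ∈ N
    · simp [hx]
    · have : f x = hf.mk f x := by
        by_contra h
        exact hx (hNsub h)
      simp [hx, this]
  · filter_upwards [hf.ae_eq_mk, measure_eq_zero_iff_ae_notMem.1 hN0] with x h1 h2
    simp [h2, h1]

theorem mainTheorem3 (d : ℕ) (r s t m α β : ℝ)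
    (hr : r ∈ Ioo (0 : ℝ) 1) (hs : s ∈ Ioo (0 : ℝ) 1) (ht : t ∈ Ioo (0 : ℝ) 1)
    (hm : m = s * r + (1 - r) * t)
    (hα : α ∈ Icc (0 : ℝ) 1) (hβ : β ∈ Icc (0 : ℝ) 1)
    (f₁ f₂ f₃ f₄ : (Fin d → ℝ) → ℝ)
    (hmeas₁ : AEMeasurable f₁ (volume.restrict (posOrthant d)))
    (hmeas₂ : AEMeasurable f₂ (volume.restrict (posOrthant d)))
    (hmeas₃ : AEMeasurable f₃ (volume.restrict (posOrthant d)))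
    (hmeas₄ : AEMeasurable f₄ (volume.restrict (posOrthant d)))
    (hpos₁ : ∀ x ∈ posOrthant d, 0 < f₁ x)
    (hpos₂ : ∀ x ∈ posOrthant d, 0 < f₂ x)
    (hpos₃ : ∀ x ∈ posOrthant d, 0 < f₃ x)
    (hpos₄ : ∀ x ∈ posOrthant d, 0 < f₄ x)
    (hineq : ∀ x ∈ posOrthant d, ∀ y ∈ posOrthant d,
      f₁ x ^ m * f₂ y ^ (1 - m) ≤
        f₃ (powerMeanVec α s x y) ^ r * f₄ (powerMeanVec β t x y) ^ (1 - r)) :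
    (∫⁻ x in posOrthant d, ENNReal.ofReal (f₁ x)) ^ m *
        (∫⁻ x in posOrthant d, ENNReal.ofReal (f₂ x)) ^ (1 - m) ≤
      (∫⁻ x in posOrthant d, ENNReal.ofReal (f₃ x)) ^ r *
        (∫⁻ x in posOrthant d, ENNReal.ofReal (f₄ x)) ^ (1 - r) := by
  have hr1 : 0 < 1 - r := sub_pos.2 hr.2
  have hs1 : 0 < 1 - s := sub_pos.2 hs.2
  have ht1 : 0 < 1 - t := sub_pos.2 ht.2
  have hr0 := hr.1
  have hs0 := hs.1
  have ht0 := ht.1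
  have hm0 : 0 ≤ m := by rw [hm]; positivity
  have hm1 : 0 ≤ 1 - m := by
    rw [show 1 - m = (1 - s) * r + (1 - t) * (1 - r) by rw [hm]; ring]; positivity
  -- Minorants of f₁, f₂ and majorants of f₃, f₄ with the same integrals preserve the hypothesis
  -- pointwise.
  obtain ⟨g₁, hg₁, hle₁, he₁⟩ := exists_measurable_le_lintegral_eq (volume.restrict (posOrthant d))
    fun x => ENNReal.ofReal (f₁ x)
  obtain ⟨g₂, hg₂, hle₂, he₂⟩ := exists_measurable_le_lintegral_eq (volume.restrict (posOrthant d))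
    fun x => ENNReal.ofReal (f₂ x)
  obtain ⟨g₃, hg₃, hle₃, he₃⟩ := exists_measurable_ge_lintegral_eq hmeas₃.ennreal_ofReal
  obtain ⟨g₄, hg₄, hle₄, he₄⟩ := exists_measurable_ge_lintegral_eq hmeas₄.ennreal_ofReal
  rw [he₁, he₂, ← he₃, ← he₄]
  refine powerMeanVec_lintegral_le hr hs ht hm hα hβ d hg₁ hg₂ hg₃ hg₄ fun x hx y hy => ?_
  have hx₁ := hpos₁ x hx
  have hy₂ := hpos₂ y hy
  have h₃ := hpos₃ (powerMeanVec α s x y) fun i => powerMean_pos hs (hx i) (hy i)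
  have h₄ := hpos₄ (powerMeanVec β t x y) fun i => powerMean_pos ht (hx i) (hy i)
  calc g₁ x ^ m * g₂ y ^ (1 - m)
      ≤ ENNReal.ofReal (f₁ x) ^ m * ENNReal.ofReal (f₂ y) ^ (1 - m) :=
        mul_le_mul' (ENNReal.rpow_le_rpow (hle₁ x) hm0) (ENNReal.rpow_le_rpow (hle₂ y) hm1)
    _ ≤ ENNReal.ofReal (f₃ (powerMeanVec α s x y)) ^ r *
        ENNReal.ofReal (f₄ (powerMeanVec β t x y)) ^ (1 - r) := by
        rw [ENNReal.ofReal_rpow_of_pos hx₁, ENNReal.ofReal_rpow_of_pos hy₂,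
          ENNReal.ofReal_rpow_of_pos h₃, ENNReal.ofReal_rpow_of_pos h₄,
          ← ENNReal.ofReal_mul (by positivity), ← ENNReal.ofReal_mul (by positivity)]
        exact ENNReal.ofReal_le_ofReal (hineq x hx y hy)
    _ ≤ _ := mul_le_mul' (ENNReal.rpow_le_rpow (hle₃ _) hr0.le)
        (ENNReal.rpow_le_rpow (hle₄ _) hr1.le)
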